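/- Conventions: a theory is a set of sentences over a first-order signature $\Pi$; structures are non-empty. For a theory $\mathcal{T}$ and formulae $F,G$, $F\models_{\mathcal{T}}G$ means that every model of $\mathcal{T}$ and $F$ is a model of $G$. A theory is *universal* if it is axiomatized by universal sentences. - $\mathcal{T}$ has *ground interpolation* if for all ground (quantifier- and variable-free) formulae $A$ and $B$ over $\Pi$ extended with additional constants, such that $A\wedge B\models_{\mathcal{T}}\bot$, there is a ground formula $I$ over the extended signature such that every additional constant occurring in $I$ occurs both in $A$ and in $B$ (symbols of $\Pi$ may be used freely in $I$), $A\models_{\mathcal{T}}I$, and $B\wedge I\models_{\mathcal{T}}\bot$. - $\mathcal{T}$ *admits quantifier elimination* if every formula $\phi(x_1,\dots,x_n)$ over $\Pi$ ($n\ge 0$) is equivalent modulo $\mathcal{T}$ to a quantifier-free formula $\phi^*(x_1,\dots,x_n)$ over $\Pi$ (where $\bot$ counts as a quantifier-free formula). - $\mathcal{T}^*$ is a *model companion* of $\mathcal{T}$ (both over $\Pi$) if every model of $\mathcal{T}$ embeds into a model of $\mathcal{T}^*$ and vice versa, and $\mathcal{T}^*$ is model complete, i.e. all embeddings between models of $\mathcal{T}^*$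 are elementary. - $\mathcal{T}^*$ is a *model completion* of $\mathcal{T}$ if it is a model companion of $\mathcal{T}$ and, for every model $\mathcal{A}$ of $\mathcal{T}$, the theory $\mathcal{T}^*\cup\Delta(\mathcal{A})$ is complete, where the diagram $\Delta(\mathcal{A})$ is the set of all literals true in $\mathcal{A}$ over $\Pi$ extended with a constant naming each element of $\mathcal{A}$. (A theory is complete if it has a model and all its models are elementarily equivalent.) **Theorem.** Let $\mathcal{T}$ be a universal theory and let $\mathcal{T}^*$ be a model companion of $\mathcal{T}$. If $\mathcal{T}$ has ground interpolation, then $\mathcal{T}^*$ admits quantifier elimination and $\mathcal{T}^*$ is a model completion of $\mathcal{T}$. Moreover, $\mathcal{T}$ has ground interpolation if and only if $\mathcal{T}^*$ has ground interpolation. -/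

import Mathlib

open FirstOrder

universe u v w

namespace FirstOrder.Language

variable {L : Language.{u, v}}

/-- The additional constants (elements of `C`) given by a function symbol of the expansion `L[[C]]`
of `L`: a singleton for a new constant symbol, and nothing for a symbol of `L`. -/
def symbolNewConstants {C : Type w} : ∀ {n : ℕ}, L[[C]].Functions n → Set C
  | _, Sum.inl _ => ∅
  | 0, Sum.inr c => {c}
  | _ + 1, Sum.inr _ => ∅

/-- The additional constants occurring in a term over `L[[C]]`. -/
def Term.newConstants {C : Type w} {α : Type*} : L[[C]].Term α → Set C
  | .var _ => ∅
  | .func f ts => symbolNewConstants f ∪ ⋃ i, (ts i).newConstants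

/-- The additional constants occurring in a formula over `L[[C]]`. -/
def BoundedFormula.newConstants {C : Type w} {α : Type*} :
    ∀ {n : ℕ}, L[[C]].BoundedFormula α n → Set C
  | _, .falsum => ∅
  | _, .equal t₁ t₂ => t₁.newConstants ∪ t₂.newConstants
  | _, .rel _ ts => ⋃ i, (ts i).newConstants
  | _, .imp φ ψ => φ.newConstants ∪ ψ.newConstants
  | _, .all φ => φ.newConstants

/-- The diagram of a structure `M`: all literals over `L[[M]]` (atomic sentences and negations of
atomic sentences) that hold in `M`, each new constant being interpreted by the element it names. -/
def diagram (L : Language.{u, v}) (M : Type w) [L.Structure M] : L[[M]].Theory :=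
  {φ | (BoundedFormula.IsAtomic φ ∨
      ∃ ψ : L[[M]].Sentence, BoundedFormula.IsAtomic ψ ∧ φ = Formula.not ψ) ∧ M ⊨ φ}

namespace Theory

/-- A theory is universal if it is axiomatized by universal sentences, i.e. if it has the same
consequences as some set of universal sentences. -/
def IsUniversallyAxiomatized (T : L.Theory) : Prop :=
  ∃ U : L.Theory, U.IsUniversal ∧ (∀ φ ∈ U, T ⊨ᵇ φ) ∧ (∀ φ ∈ T, U ⊨ᵇ φ)

/-- Ground interpolation. The additional constants are drawn from the countable supply `ℕ`.
Ground formulas are quantifier-free sentences. The symbols of `L` may be used freely in the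
interpolant; the additional constants in it must occur in both `A` and `B`. -/
def HasGroundInterpolation (T : L.Theory) : Prop :=
  ∀ A B : L[[ℕ]].Sentence, BoundedFormula.IsQF A → BoundedFormula.IsQF B →
    (L.lhomWithConstants ℕ).onTheory T ∪ {A ⊓ B} ⊨ᵇ (⊥ : L[[ℕ]].Sentence) →
    ∃ I : L[[ℕ]].Sentence, BoundedFormula.IsQF I ∧
      BoundedFormula.newConstants I ⊆
        BoundedFormula.newConstants A ∩ BoundedFormula.newConstants B ∧
      (L.lhomWithConstants ℕ).onTheory T ∪ {A} ⊨ᵇ I ∧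
      (L.lhomWithConstants ℕ).onTheory T ∪ {B ⊓ I} ⊨ᵇ (⊥ : L[[ℕ]].Sentence)

/-- Every formula in finitely many free variables (possibly none) is equivalent modulo `T` to a
quantifier-free formula in the same free variables. -/
def HasQuantifierElimination (T : L.Theory) : Prop :=
  ∀ (n : ℕ) (φ : L.Formula (Fin n)), ∃ ψ : L.Formula (Fin n),
    BoundedFormula.IsQF ψ ∧ φ ⇔[T] ψ

/-- All embeddings between models of `T` are elementary. -/
def IsModelComplete (T : L.Theory) : Prop :=
  ∀ (M N : ModelType.{u, v, max u v} T) (f : M ↪[L] N), ∃ g : M ↪ₑ[L] N, (g : M → N) = f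

/-- Every model of each of the two theories embeds into a model of the other one. -/
def AreCoTheories (T₁ T₂ : L.Theory) : Prop :=
  (∀ M : ModelType.{u, v, max u v} T₁, ∃ N : ModelType.{u, v, max u v} T₂, Nonempty (M ↪[L] N)) ∧
  (∀ N : ModelType.{u, v, max u v} T₂, ∃ M : ModelType.{u, v, max u v} T₁, Nonempty (N ↪[L] M))

/-- `Tstar` is a model companion of `T`. -/
def IsModelCompanion (Tstar T : L.Theory) : Prop :=
  AreCoTheories T Tstar ∧ Tstar.IsModelComplete

/-- `Tstar` is a model completion of `T`: a model companion such that `Tstar` together with the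
diagram of any model of `T` is a complete theory. -/
def IsModelCompletion (Tstar T : L.Theory) : Prop :=
  IsModelCompanion Tstar T ∧
    ∀ M : ModelType.{u, v, max u v} T,
      ((L.lhomWithConstants M).onTheory Tstar ∪ L.diagram M).IsComplete

end Theory

end FirstOrder.Language

/-!
Co-theories have the same consequences of the form `A ⟹ B` with `A` and `B` quantifier-free, so
ground interpolation passes between `T` and `Tstar`.

The additional constants in ground interpolation act as free variables. By model completeness every
formula `φ(x)` and its negation are existential modulo `Tstar`, say `φ ⇔ ∃ y, A(x, y)` and
`¬φ ⇔ ∃ z, B(x, z)`. Then `A` and `B` are jointly inconsistent, and an interpolant `I(x)` is implied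
by `φ` and excluded by `¬φ`: it is a quantifier-free equivalent of `φ`.

Quantifier elimination reduces every sentence with parameters in a model `M` of `T` to a
quantifier-free one, whose truth value is the same in `M` and in every model of `Tstar` containing
`M`; hence `Tstar` together with the diagram of `M` is complete.
-/

namespace GroundInterpolation

open FirstOrder.Language FirstOrder.Language.Theory
open BoundedFormula (IsQF IsAtomic)

variable {L : FirstOrder.Language.{u, v}} {T Tstar : L.Theory}

section Imp

variable {α : Type w} {φ ψ : L.Formula α}

theorem imp_iff_forall_realize :
    φ ⟹[T] ψ ↔ ∀ (M : ModelType.{u, v, max u v w} T) (v : α → M), φ.Realize v → ψ.Realize v :=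
  models_formula_iff (φ := Formula.imp φ ψ)

theorem iff_iff_forall_realize : φ ⇔[T] ψ ↔
    ∀ (M : ModelType.{u, v, max u v w} T) (v : α → M), φ.Realize v ↔ ψ.Realize v := by
  simp only [iff_iff_imp_and_imp, imp_iff_forall_realize, ← forall_and, iff_iff_implies_and_implies]

theorem realize_of_imp (h : φ ⟹[T] ψ) {M : Type*} [L.Structure M] [Nonempty M] [M ⊨ T]
    {v : α → M} (hφ : φ.Realize v) : ψ.Realize v :=
  (ModelsBoundedFormula.realize_formula (φ := Formula.imp φ ψ) h M) hφ

theorem imp_not_comm : φ ⟹[T] ψ.not ↔ ψ ⟹[T] φ.not := by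
  simp only [imp_iff_forall_realize, Formula.realize_not]
  exact forall₂_congr fun M v => _root_.imp_not_comm

theorem imp_not_not_iff : φ ⟹[T] ψ.not.not ↔ φ ⟹[T] ψ :=
  ⟨fun h => h.trans (Formula.iff_not_not ψ).mpr, fun h => h.trans (Formula.iff_not_not ψ).mp⟩

theorem sup_imp_iff {χ : L.Formula α} : φ ⊔ ψ ⟹[T] χ ↔ φ ⟹[T] χ ∧ ψ ⟹[T] χ := by
  simp only [imp_iff_forall_realize, Formula.realize_sup, or_imp, forall_and]

theorem union_singleton_models_iff {φ ψ : L.Sentence} : T ∪ {φ} ⊨ᵇ ψ ↔ φ ⟹[T] ψ := by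
  rw [models_sentence_iff, imp_iff_forall_realize]
  refine ⟨fun h M v hφ => ?_, fun h M => ?_⟩
  · rw [Subsingleton.elim v default] at hφ ⊢
    have : M ⊨ T ∪ {φ} := M.is_model.union (model_singleton_iff.2 hφ)
    exact h (ModelType.of (T ∪ {φ}) M)
  · have : M ⊨ T := M.is_model.mono Set.subset_union_left
    exact h (ModelType.of T M) default (M.is_model.realize_of_mem φ (Or.inr rfl))

theorem imp_iff_equivSentence_imp : φ ⟹[T] ψ ↔
    Formula.equivSentence φ ⟹[(L.lhomWithConstants α).onTheory T] Formula.equivSentence ψ :=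
  models_formula_iff_onTheory_models_equivSentence (φ := Formula.imp φ ψ)

end Imp

section QuantifierFree

variable {L' : FirstOrder.Language} {α β : Type*} {n : ℕ}

theorem isAtomic_mapTermRel {g : ℕ → ℕ} (ft : ∀ n, L.Term (α ⊕ Fin n) → L'.Term (β ⊕ Fin (g n)))
    (fr : ∀ n, L.Relations n → L'.Relations n)
    (h : ∀ n, L'.BoundedFormula β (g (n + 1)) → L'.BoundedFormula β (g n + 1))
    {φ : L.BoundedFormula α n} (hφ : IsAtomic φ) : IsAtomic (φ.mapTermRel ft fr h) := by
  cases hφ with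
  | equal => exact .equal _ _
  | rel => exact .rel _ _

theorem isQF_mapTermRel {g : ℕ → ℕ} (ft : ∀ n, L.Term (α ⊕ Fin n) → L'.Term (β ⊕ Fin (g n)))
    (fr : ∀ n, L.Relations n → L'.Relations n)
    (h : ∀ n, L'.BoundedFormula β (g (n + 1)) → L'.BoundedFormula β (g n + 1))
    {φ : L.BoundedFormula α n} (hφ : IsQF φ) : IsQF (φ.mapTermRel ft fr h) := by
  induction hφ with
  | falsum => exact .falsum
  | of_isAtomic hφ => exact (isAtomic_mapTermRel ft fr h hφ).isQF
  | imp _ _ ih₁ ih₂ => exact ih₁.imp ih₂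

theorem isAtomic_equivSentence {φ : L.Formula α} (hφ : IsAtomic φ) :
    IsAtomic (Formula.equivSentence φ) :=
  isAtomic_mapTermRel _ _ _ (isAtomic_mapTermRel _ _ _ hφ)

theorem isAtomic_equivSentence_symm {σ : L[[α]].Sentence} (hσ : IsAtomic σ) :
    IsAtomic (Formula.equivSentence.symm σ) :=
  isAtomic_mapTermRel _ _ _ (isAtomic_mapTermRel _ _ _ hσ)

theorem isQF_equivSentence_iff {φ : L.Formula α} : IsQF (Formula.equivSentence φ) ↔ IsQF φ := by
  refine ⟨fun h => ?_, fun h => isQF_mapTermRel _ _ _ (isQF_mapTermRel _ _ _ h)⟩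
  rw [← Formula.equivSentence.symm_apply_apply φ]
  exact isQF_mapTermRel _ _ _ (isQF_mapTermRel _ _ _ h)

theorem isQF_relabel {φ : L.Formula α} (hφ : IsQF φ) (g : α → β) : IsQF (φ.relabel g) :=
  IsQF.relabel (m := 0) (n := 0) hφ _

theorem isQF_restrictFreeVar [DecidableEq α] {φ : L.BoundedFormula α n} (hφ : IsQF φ)
    (f : φ.freeVarFinset → β) : IsQF (φ.restrictFreeVar f) := by
  induction hφ with
  | falsum => exact .falsum
  | of_isAtomic hφ =>
    cases hφ with
    | equal => exact (IsAtomic.equal _ _).isQF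
    | rel => exact (IsAtomic.rel _ _).isQF
  | imp _ _ ih₁ ih₂ => exact (ih₁ _).imp (ih₂ _)

theorem realize_comp_embedding_iff {φ : L.Formula α} (hφ : IsQF φ) {M N : Type*} [L.Structure M]
    [L.Structure N] (f : M ↪[L] N) (v : α → M) : φ.Realize (f ∘ v) ↔ φ.Realize v := by
  rw [Formula.Realize, Formula.Realize, ← hφ.realize_embedding f]
  exact iff_of_eq (congrArg _ (Subsingleton.elim _ _))

end QuantifierFree

section FreeVariables

variable {L' : FirstOrder.Language} {α β γ δ : Type*} {C : Type w} {n : ℕ}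
variable [DecidableEq α] [DecidableEq β]

theorem varFinsetLeft_relabel_map (t : L.Term (α ⊕ γ)) (f : α → β) (g : γ → δ) :
    (t.relabel (Sum.map f g)).varFinsetLeft = t.varFinsetLeft.image f := by
  induction t with
  | var x => cases x <;> simp [Term.varFinsetLeft]
  | func F ts ih => simp only [Term.relabel, Term.varFinsetLeft, ih, Finset.biUnion_image]

theorem freeVarFinset_mapTermRel {g : ℕ → ℕ}
    {ft : ∀ n, L.Term (α ⊕ Fin n) → L'.Term (β ⊕ Fin (g n))}
    {fr : ∀ n, L.Relations n → L'.Relations n}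
    {h : ∀ n, L'.BoundedFormula β (g (n + 1)) → L'.BoundedFormula β (g n + 1)} {f : α → β}
    (hft : ∀ n t, (ft n t).varFinsetLeft = t.varFinsetLeft.image f)
    (hh : ∀ n ψ, (h n ψ).freeVarFinset = ψ.freeVarFinset) (φ : L.BoundedFormula α n) :
    (φ.mapTermRel ft fr h).freeVarFinset = φ.freeVarFinset.image f := by
  induction φ with
  | falsum => simp [BoundedFormula.mapTermRel]
  | equal => simp [BoundedFormula.mapTermRel, hft, Finset.image_union]
  | rel => simp [BoundedFormula.mapTermRel, hft, Finset.biUnion_image]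
  | imp _ _ ih₁ ih₂ => simp [BoundedFormula.mapTermRel, ih₁, ih₂, Finset.image_union]
  | all _ ih => simp [BoundedFormula.mapTermRel, hh, ih]

theorem freeVarFinset_castLE {m n : ℕ} (h : m ≤ n) (φ : L.BoundedFormula α m) :
    (φ.castLE h).freeVarFinset = φ.freeVarFinset := by
  induction φ generalizing n with
  | falsum => rfl
  | equal => simp [varFinsetLeft_relabel_map]
  | rel => simp [varFinsetLeft_relabel_map]
  | imp _ _ ih₁ ih₂ => simp [ih₁, ih₂]
  | all _ ih => simp [ih]

theorem freeVarFinset_relabel (φ : L.Formula α) (g : α → β) :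
    (φ.relabel g).freeVarFinset = φ.freeVarFinset.image g := by
  refine freeVarFinset_mapTermRel (fun n t => ?_) (fun n ψ => freeVarFinset_castLE _ ψ) φ
  rw [← varFinsetLeft_relabel_map t g (finSumFinEquiv ∘ Sum.inr)]
  congr 2
  ext x
  rcases x with x | x <;> rfl

theorem newConstants_constantsVarsEquivLeft_symm [DecidableEq C] (t : L.Term ((C ⊕ α) ⊕ γ)) :
    (Term.constantsVarsEquivLeft.symm t).newConstants = {c | Sum.inl c ∈ t.varFinsetLeft} := by
  induction t with
  | var x =>
    rcases x with (c | a) | x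
    · refine (Set.union_eq_left.2 (Set.iUnion_subset fun i => i.elim0)).trans
        (?_ : ({c} : Set C) = _)
      ext
      simp [Term.varFinsetLeft]
    · simp [Term.newConstants, Term.varFinsetLeft]
    · simp [Term.newConstants, Term.varFinsetLeft]
  | func F ts ih =>
    simp only [Term.constantsVarsEquivLeft_symm_apply] at ih
    ext
    simp [Term.newConstants, symbolNewConstants, Term.varFinsetLeft, ih]

theorem newConstants_constantsVarsEquiv_symm [DecidableEq C] (φ : L.BoundedFormula (C ⊕ α) n) :
    BoundedFormula.newConstants (BoundedFormula.constantsVarsEquiv.symm φ) =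
      {c | Sum.inl c ∈ φ.freeVarFinset} := by
  induction φ with
  | falsum => exact (Set.eq_empty_of_forall_notMem fun c => Finset.notMem_empty (Sum.inl c)).symm
  | equal t₁ t₂ =>
    refine (congrArg₂ (· ∪ ·) (newConstants_constantsVarsEquivLeft_symm t₁)
      (newConstants_constantsVarsEquivLeft_symm t₂)).trans ?_
    ext
    simp
  | rel R ts =>
    refine (Set.iUnion_congr fun i => newConstants_constantsVarsEquivLeft_symm (ts i)).trans ?_
    ext
    simp
  | imp _ _ ih₁ ih₂ =>
    refine (congrArg₂ (· ∪ ·) ih₁ ih₂).trans ?_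
    ext
    simp
  | all _ ih => exact ih

theorem newConstants_equivSentence (φ : L.Formula α) :
    BoundedFormula.newConstants (Formula.equivSentence φ) = φ.freeVarFinset := by
  have hrelabel : ((BoundedFormula.relabelEquiv (Equiv.sumEmpty α Empty)).symm φ).freeVarFinset =
      φ.freeVarFinset.image Sum.inl :=
    freeVarFinset_mapTermRel (fun _ t => varFinsetLeft_relabel_map t _ id) (fun _ _ => rfl) φ
  refine (newConstants_constantsVarsEquiv_symm _).trans ?_
  ext
  simp [hrelabel]

end FreeVariables

section Relabel

variable {α β γ : Type*}

theorem relabel_imp_relabel_iff {φ ψ : L.Formula α} {g : α → β} (hg : g.Injective) :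
    φ.relabel g ⟹[T] ψ.relabel g ↔ φ ⟹[T] ψ := by
  refine ⟨fun h => imp_iff_forall_realize.2 fun M v hφ => ?_,
    fun h => imp_iff_forall_realize.2 fun M v hφ => ?_⟩
  · rw [← Function.extend_comp hg v fun _ => Classical.arbitrary M] at hφ ⊢
    exact Formula.realize_relabel.1 (realize_of_imp h (Formula.realize_relabel.2 hφ))
  · exact Formula.realize_relabel.2 (realize_of_imp h (Formula.realize_relabel.1 hφ))

theorem relabel_comp_iff (φ : L.Formula α) (f : α → β) (g : β → γ) :
    φ.relabel (g ∘ f) ⇔[T] (φ.relabel f).relabel g :=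
  iff_iff_forall_realize.2 fun M v => by simp only [Formula.realize_relabel, Function.comp_assoc]

theorem iff_relabel_restrictFreeVar [DecidableEq β] (φ : L.Formula β) {f : φ.freeVarFinset → α}
    {g : α → β} (hfg : ∀ b, g (f b) = b) :
    φ ⇔[T] Formula.relabel g (φ.restrictFreeVar f) := by
  refine iff_iff_forall_realize.2 fun M v => ?_
  rw [Formula.realize_relabel]
  exact (BoundedFormula.realize_restrictFreeVar (v := v ∘ g) v fun b => congrArg v (hfg b)).symm

theorem exists_iff_relabel_of_freeVarFinset_subset_range [DecidableEq β] {φ : L.Formula β}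
    (hφ : IsQF φ) {g : α → β} (hg : ↑φ.freeVarFinset ⊆ Set.range g) :
    ∃ ψ : L.Formula α, IsQF ψ ∧ φ ⇔[T] ψ.relabel g := by
  choose f hf using fun b : φ.freeVarFinset => hg b.2
  exact ⟨φ.restrictFreeVar f, isQF_restrictFreeVar hφ f, iff_relabel_restrictFreeVar φ hf⟩

end Relabel

section Interpolation

theorem union_inf_models_bot_iff {φ ψ : L.Sentence} :
    T ∪ {φ ⊓ ψ} ⊨ᵇ (⊥ : L.Sentence) ↔ φ ⟹[T] ψ.not := by
  rw [union_singleton_models_iff, imp_iff_forall_realize, imp_iff_forall_realize]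
  exact forall₂_congr fun M v => by
    simp only [Formula.realize_inf, Formula.realize_bot, Formula.realize_not, not_and, imp_false]

theorem hasGroundInterpolation_iff : T.HasGroundInterpolation ↔ ∀ A B : L.Formula ℕ,
    IsQF A → IsQF B → A ⟹[T] B → ∃ I : L.Formula ℕ, IsQF I ∧
      I.freeVarFinset ⊆ A.freeVarFinset ∩ B.freeVarFinset ∧ A ⟹[T] I ∧ I ⟹[T] B := by
  unfold Theory.HasGroundInterpolation
  simp only [union_inf_models_bot_iff]
  simp only [union_singleton_models_iff,
    ← Formula.equivSentence.forall_congr_right, ← Formula.equivSentence.exists_congr_right,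
    isQF_equivSentence_iff, newConstants_equivSentence, ← Formula.equivSentence_not,
    ← imp_iff_equivSentence_imp, ← Finset.coe_inter, Finset.coe_subset]
  refine ⟨fun h A B hA hB hAB => ?_, fun h A B hA hB hAB => ?_⟩
  · obtain ⟨I, hI, hfree, hAI, hBI⟩ := h A B.not hA hB.not (imp_not_not_iff.2 hAB)
    exact ⟨I, hI, by simpa using hfree, hAI, imp_not_not_iff.1 (imp_not_comm.1 hBI)⟩
  · obtain ⟨I, hI, hfree, hAI, hIB⟩ := h A B.not hA hB.not hAB
    exact ⟨I, hI, by simpa using hfree, hAI, imp_not_comm.1 hIB⟩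

theorem exists_isQF_interpolant (hT : T.HasGroundInterpolation) {α β₁ β₂ : Type*}
    [Countable α] [Countable β₁] [Countable β₂] {A : L.Formula (α ⊕ β₁)} {B : L.Formula (α ⊕ β₂)}
    (hA : IsQF A) (hB : IsQF B) (hAB : A.relabel (Sum.map id Sum.inl : _ → α ⊕ (β₁ ⊕ β₂)) ⟹[T]
      B.relabel (Sum.map id Sum.inr : _ → α ⊕ (β₁ ⊕ β₂))) :
    ∃ I : L.Formula α, IsQF I ∧ A ⟹[T] I.relabel Sum.inl ∧ I.relabel Sum.inl ⟹[T] B := by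
  classical
  obtain ⟨e, he⟩ := Countable.exists_injective_nat (α ⊕ (β₁ ⊕ β₂))
  let e₁ : α ⊕ β₁ → ℕ := e ∘ Sum.map id Sum.inl
  let e₂ : α ⊕ β₂ → ℕ := e ∘ Sum.map id Sum.inr
  have he₁ : e₁.Injective := he.comp (Function.injective_id.sumMap Sum.inl_injective)
  have he₂ : e₂.Injective := he.comp (Function.injective_id.sumMap Sum.inr_injective)
  have hABe : A.relabel e₁ ⟹[T] B.relabel e₂ :=
    ((relabel_comp_iff A _ e).mp.trans ((relabel_imp_relabel_iff he).2 hAB)).trans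
      (relabel_comp_iff B _ e).mpr
  obtain ⟨J, hJ, hfree, hAJ, hJB⟩ := hasGroundInterpolation_iff.1 hT (A.relabel e₁) (B.relabel e₂)
    (isQF_relabel hA e₁) (isQF_relabel hB e₂) hABe
  have hrange : ↑J.freeVarFinset ⊆ Set.range (e ∘ Sum.inl) := by
    intro i hi
    obtain ⟨hi₁, hi₂⟩ := Finset.mem_inter.1 (hfree hi)
    rw [freeVarFinset_relabel, Finset.mem_image] at hi₁ hi₂
    obtain ⟨x, -, rfl⟩ := hi₁
    obtain ⟨y, -, hxy⟩ := hi₂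
    have := he hxy
    rcases x with a | b <;> rcases y with a' | b' <;> simp_all [e₁]
  obtain ⟨I, hI, hIJ⟩ := exists_iff_relabel_of_freeVarFinset_subset_range hJ hrange
  refine ⟨I, hI, (relabel_imp_relabel_iff he₁).1 ?_, (relabel_imp_relabel_iff he₂).1 ?_⟩
  · exact hAJ.trans (hIJ.mp.trans (relabel_comp_iff I Sum.inl e₁).mp)
  · exact (relabel_comp_iff I Sum.inl e₂).mpr.trans (hIJ.mpr.trans hJB)

end Interpolation

section CoTheories

variable {T₁ T₂ : L.Theory}

theorem imp_of_forall_exists_embedding {α : Type} {φ ψ : L.Formula α}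
    (h : ∀ M : ModelType.{u, v, max u v} T₂, ∃ N : ModelType.{u, v, max u v} T₁,
      Nonempty (M ↪[L] N)) (hφ : IsQF φ) (hψ : IsQF ψ) (hφψ : φ ⟹[T₁] ψ) : φ ⟹[T₂] ψ := by
  refine imp_iff_forall_realize.2 fun M v hv => ?_
  obtain ⟨N, ⟨f⟩⟩ := h M
  rw [← realize_comp_embedding_iff hφ f] at hv
  rw [← realize_comp_embedding_iff hψ f]
  exact realize_of_imp hφψ hv

theorem hasGroundInterpolation_congr (h : AreCoTheories T₁ T₂) :
    T₁.HasGroundInterpolation ↔ T₂.HasGroundInterpolation := by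
  have imp_congr_of_isQF {φ ψ : L.Formula ℕ} (hφ : IsQF φ) (hψ : IsQF ψ) :
      φ ⟹[T₁] ψ ↔ φ ⟹[T₂] ψ :=
    ⟨imp_of_forall_exists_embedding h.2 hφ hψ, imp_of_forall_exists_embedding h.1 hφ hψ⟩
  rw [hasGroundInterpolation_iff, hasGroundInterpolation_iff]
  exact forall₄_congr fun A B hA hB => imp_congr (imp_congr_of_isQF hA hB) <|
    exists_congr fun I => and_congr_right fun hI => and_congr_right' <|
      and_congr (imp_congr_of_isQF hA hI) (imp_congr_of_isQF hI hB)

end CoTheories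

section Diagram

variable {M N : Type*} [L.Structure M] [L.Structure N]

/-- A map under which atomic formulas are preserved and reflected, as an embedding. -/
def embeddingOfRealizeIff (j : M → N)
    (h : ∀ ψ : L.Formula M, IsAtomic ψ → (ψ.Realize id ↔ ψ.Realize j)) : M ↪[L] N where
  toFun := j
  inj' x y hxy := by
    have := h ((Term.var x).equal (Term.var y)) (.equal _ _)
    simp only [Formula.realize_equal, Term.realize_var] at this
    exact this.2 hxy
  map_fun' f x := by
    have := h ((Term.func f fun i => Term.var (x i)).equal (Term.var (Structure.funMap f x)))
      (.equal _ _)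
    simp only [Formula.realize_equal, Term.realize] at this
    exact (this.1 rfl).symm
  map_rel' R x := by
    have := h (R.formula fun i => Term.var (x i)) (.rel _ _)
    simp only [Formula.realize_rel, Term.realize_var] at this
    exact this.symm

variable [L[[M]].Structure N] [(L.lhomWithConstants M).IsExpansionOn N]

theorem models_diagram_iff_realize_con : N ⊨ L.diagram M ↔ ∀ ψ : L.Formula M, IsAtomic ψ →
    (ψ.Realize id ↔ ψ.Realize fun m => (L.con m : N)) := by
  have hN (ψ : L.Formula M) : N ⊨ Formula.equivSentence ψ ↔ ψ.Realize fun m => (L.con m : N) :=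
    Formula.realize_equivSentence N ψ
  have hM (ψ : L.Formula M) : M ⊨ Formula.equivSentence ψ ↔ ψ.Realize id :=
    Formula.realize_equivSentence M ψ
  simp only [← hN, ← hM, model_iff]
  refine ⟨fun h ψ hψ => ⟨fun hψM => ?_, not_imp_not.1 fun hψM => ?_⟩, ?_⟩
  · exact h _ ⟨.inl (isAtomic_equivSentence hψ), hψM⟩
  · exact h _ ⟨.inr ⟨_, isAtomic_equivSentence hψ, rfl⟩, hψM⟩
  · rintro h σ ⟨hσ | ⟨τ, hτ, rfl⟩, hσM⟩
    · have := h _ (isAtomic_equivSentence_symm hσ)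
      rw [Equiv.apply_symm_apply] at this
      exact this.1 hσM
    · have := h _ (isAtomic_equivSentence_symm hτ)
      rw [Equiv.apply_symm_apply] at this
      exact fun hτN => hσM (this.2 hτN)

theorem models_diagram_iff_exists_embedding :
    N ⊨ L.diagram M ↔ ∃ F : M ↪[L] N, ∀ m, F m = (L.con m : N) := by
  rw [models_diagram_iff_realize_con]
  refine ⟨fun h => ⟨embeddingOfRealizeIff _ h, fun _ => rfl⟩, fun ⟨F, hF⟩ ψ hψ => ?_⟩
  rw [← funext hF]
  exact (realize_comp_embedding_iff hψ.isQF F id).symm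

end Diagram

section Compactness

variable {α : Type w}

theorem isSatisfiable_onTheory_union_image_equivSentence_iff {Γ : Set (L.Formula α)} :
    ((L.lhomWithConstants α).onTheory T ∪ Formula.equivSentence '' Γ).IsSatisfiable ↔
      ∃ (M : ModelType.{u, v, max u v w} T) (v : α → M), ∀ φ ∈ Γ, φ.Realize v := by
  refine ⟨fun ⟨K⟩ => ?_, fun ⟨M, v, hv⟩ => ?_⟩
  · let := (L.lhomWithConstants α).reduct K
    have : K ⊨ T := (LHom.onTheory_model (L.lhomWithConstants α) T).1
      (K.is_model.mono Set.subset_union_left)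
    refine ⟨ModelType.of T K, fun a => (L.con a : K), fun φ hφ => ?_⟩
    exact (Formula.realize_equivSentence K φ).1
      (K.is_model.realize_of_mem _ (.inr (Set.mem_image_of_mem _ hφ)))
  · let := constantsOn.structure v
    have hT : M ⊨ (L.lhomWithConstants α).onTheory T := (LHom.onTheory_model _ _).2 M.is_model
    have hΓ : M ⊨ Formula.equivSentence '' Γ :=
      ⟨Set.forall_mem_image.2 fun φ hφ => (Formula.realize_equivSentence M φ).2 (hv φ hφ)⟩
    have := hT.union hΓ
    exact Model.isSatisfiable M

theorem directedOn_imp_of_sup_mem {P : Set (L.Formula α)}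
    (hP : ∀ φ ∈ P, ∀ ψ ∈ P, φ ⊔ ψ ∈ P) : DirectedOn T.Imp P :=
  fun φ hφ ψ hψ => ⟨φ ⊔ ψ, hP φ hφ ψ hψ, sup_imp_iff.1 (.refl _)⟩

theorem exists_imp_of_directedOn {φ : L.Formula α} {P : Set (L.Formula α)} (hne : P.Nonempty)
    (hdir : DirectedOn T.Imp P)
    (h : ∀ (M : ModelType.{u, v, max u v w} T) (v : α → M), φ.Realize v → ∃ ρ ∈ P, ρ.Realize v) :
    ∃ ρ ∈ P, φ ⟹[T] ρ := by
  by_contra! hP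
  have : Nonempty P := hne.to_subtype
  suffices hsat : IsSatisfiable (⋃ ρ : P, (L.lhomWithConstants α).onTheory T ∪
      Formula.equivSentence '' {φ, ρ.1.not}) by
    rw [← Set.union_iUnion, ← Set.image_iUnion,
      isSatisfiable_onTheory_union_image_equivSentence_iff] at hsat
    obtain ⟨M, v, hv⟩ := hsat
    simp only [Set.mem_iUnion, Set.mem_insert_iff, Set.mem_singleton_iff] at hv
    obtain ⟨ρ, hρ, hρv⟩ := h M v (hv φ ⟨Classical.arbitrary P, .inl rfl⟩)
    exact hv ρ.not ⟨⟨ρ, hρ⟩, .inr rfl⟩ hρv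
  rw [isSatisfiable_iUnion_iff_isSatisfiable_iUnion_finset]
  intro s
  obtain ⟨⟨(ρ : L.Formula α), hρ⟩, hsρ⟩ := hdir.directed_val.finset_le s
  obtain ⟨M, v, hφ, hρv⟩ : ∃ (M : ModelType.{u, v, max u v w} T) (v : α → M),
      φ.Realize v ∧ ¬ ρ.Realize v := by
    simpa only [imp_iff_forall_realize, not_forall, exists_prop] using hP ρ hρ
  have hΓ : ∀ ψ ∈ insert φ {ψ | ∃ σ ∈ s, ψ = σ.1.not}, ψ.Realize v := by
    rintro ψ (rfl | ⟨σ, hσ, rfl⟩)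
    · exact hφ
    · exact fun hσv => hρv (realize_of_imp (hsρ σ hσ) hσv)
  refine (isSatisfiable_onTheory_union_image_equivSentence_iff.2 ⟨M, v, hΓ⟩).mono <|
    Set.iUnion₂_subset fun σ hσ => Set.union_subset_union_right _ <|
    Set.image_mono <| Set.insert_subset_insert ?_
  exact Set.singleton_subset_iff.2 ⟨σ, hσ, rfl⟩

end Compactness

section Existential

theorem iExs_imp_iff {α γ : Type*} [Finite γ] {θ : L.Formula (α ⊕ γ)} {φ : L.Formula α} :
    θ.iExs γ ⟹[T] φ ↔ θ ⟹[T] φ.relabel Sum.inl := by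
  refine ⟨fun h => imp_iff_forall_realize.2 fun M v hθ => ?_,
    fun h => imp_iff_forall_realize.2 fun M v hθ => ?_⟩
  · refine Formula.realize_relabel.2 (realize_of_imp h (Formula.realize_iExs.2 ⟨v ∘ Sum.inr, ?_⟩))
    rwa [Sum.elim_comp_inl_inr]
  · obtain ⟨w, hw⟩ := Formula.realize_iExs.1 hθ
    simpa using Formula.realize_relabel.1 (realize_of_imp h hw)

/-- A formula is existential modulo `T` if, in all models of `T`, it says that some finite tuple
satisfies a quantifier-free formula. The entries of the tuple are indexed by an arbitrary finite
type `γ`, so that two tuples can be concatenated by taking a disjoint union of index types. -/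
def IsExistentialModulo (T : L.Theory) {α : Type*} (φ : L.Formula α) : Prop :=
  ∃ (γ : Type) (_ : Finite γ) (θ : L.Formula (α ⊕ γ)), IsQF θ ∧ φ ⇔[T] θ.iExs γ

variable {α : Type*} {φ ψ : L.Formula α}

theorem isExistentialModulo_bot : IsExistentialModulo T (⊥ : L.Formula α) := by
  refine ⟨Empty, inferInstance, ⊥, .falsum, iff_iff_forall_realize.2 fun M v => ?_⟩
  simp only [Formula.realize_iExs, Formula.realize_bot, exists_const]

theorem IsExistentialModulo.sup (hφ : IsExistentialModulo T φ) (hψ : IsExistentialModulo T ψ) :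
    IsExistentialModulo T (φ ⊔ ψ) := by
  obtain ⟨γ₁, _, θ₁, hθ₁, hφ⟩ := hφ
  obtain ⟨γ₂, _, θ₂, hθ₂, hψ⟩ := hψ
  refine ⟨γ₁ ⊕ γ₂, inferInstance,
    θ₁.relabel (Sum.map id Sum.inl) ⊔ θ₂.relabel (Sum.map id Sum.inr),
    (isQF_relabel hθ₁ _).sup (isQF_relabel hθ₂ _), iff_iff_forall_realize.2 fun M v => ?_⟩
  simp only [Formula.realize_sup, hφ.realize_iff, hψ.realize_iff, Formula.realize_iExs,
    Formula.realize_relabel, Sum.elim_comp_map, Function.comp_id, exists_or]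
  exact or_congr Sum.inl_injective.surjective_comp_right.exists
    Sum.inr_injective.surjective_comp_right.exists

end Existential

section RobinsonTest

variable {α : Type}

/- A valuation in `N` of the variables in `α` and of the elements of `M` that preserves the truth of
quantifier-free formulas is an embedding of `M` into `N`, which model completeness makes elementary;
compactness then produces `θ`. -/
theorem exists_isQF_imp_relabel (hT : T.IsModelComplete) (M : ModelType.{u, v, max u v} T)
    {φ : L.Formula α} {v : α → M} (hφ : φ.Realize v) : ∃ θ : L.Formula (α ⊕ M),
      IsQF θ ∧ θ.Realize (Sum.elim v id) ∧ θ ⟹[T] φ.relabel Sum.inl := by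
  let P : Set (L.Formula (α ⊕ M)) := {θ | IsQF θ ∧ ¬ θ.Realize (Sum.elim v id)}
  have hsup : ∀ θ₁ ∈ P, ∀ θ₂ ∈ P, θ₁ ⊔ θ₂ ∈ P := fun θ₁ h₁ θ₂ h₂ =>
    ⟨h₁.1.sup h₂.1, by simp only [Formula.realize_sup, h₁.2, h₂.2, or_self, not_false_eq_true]⟩
  suffices h : ∀ (N : ModelType.{u, v, max u v} T) (w : α ⊕ M → N),
      (φ.relabel Sum.inl).not.Realize w → ∃ θ ∈ P, θ.Realize w by
    obtain ⟨θ, ⟨hθ, hθv⟩, hφθ⟩ := exists_imp_of_directedOn (T := T)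
      (⟨⊥, IsQF.falsum, id⟩ : P.Nonempty) (directedOn_imp_of_sup_mem hsup) h
    exact ⟨θ.not, hθ.not, hθv, imp_not_not_iff.1 (imp_not_comm.1 (imp_not_not_iff.2 hφθ))⟩
  intro N w hφw
  by_contra! hN
  have realize_iff {θ : L.Formula (α ⊕ M)} (hθ : IsQF θ) :
      θ.Realize (Sum.elim v id) ↔ θ.Realize w :=
    ⟨fun h => not_not.1 (hN θ.not ⟨hθ.not, not_not.2 h⟩),
      not_imp_not.1 fun h => hN θ ⟨hθ, h⟩⟩
  let f : M ↪[L] N := embeddingOfRealizeIff (w ∘ Sum.inr) fun ψ hψ => by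
    simpa only [Formula.realize_relabel, Sum.elim_comp_inr] using
      realize_iff (isQF_relabel hψ.isQF Sum.inr)
  have hf : w ∘ Sum.inl = f ∘ v := funext fun x => by
    have := realize_iff (θ := (Term.var (.inl x)).equal (Term.var (.inr (v x))))
      (IsAtomic.equal _ _).isQF
    simp only [Formula.realize_equal, Term.realize_var] at this
    exact this.1 rfl
  obtain ⟨g, hg⟩ := hT M N f
  rw [Formula.realize_not, Formula.realize_relabel, hf, ← hg, g.map_formula] at hφw
  exact hφw hφ

theorem exists_isExistentialModulo_imp (hT : T.IsModelComplete) (M : ModelType.{u, v, max u v} T)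
    {φ : L.Formula α} {v : α → M} (hφ : φ.Realize v) :
    ∃ ρ : L.Formula α, IsExistentialModulo T ρ ∧ ρ ⟹[T] φ ∧ ρ.Realize v := by
  classical
  obtain ⟨θ, hθ, hθv, hθφ⟩ := exists_isQF_imp_relabel hT M hφ
  let s : Finset M := θ.freeVarFinset.toRight
  let e : Fin s.card → M := Subtype.val ∘ s.equivFin.symm
  have he : e.Injective := Subtype.val_injective.comp s.equivFin.symm.injective
  have hrange : ↑θ.freeVarFinset ⊆ Set.range (Sum.map id e : α ⊕ _ → α ⊕ M) := by
    rintro (x | m) h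
    · exact ⟨.inl x, rfl⟩
    · exact ⟨.inr (s.equivFin ⟨m, Finset.mem_toRight.2 h⟩), by simp [e]⟩
  obtain ⟨θ', hθ', hθθ'⟩ := exists_iff_relabel_of_freeVarFinset_subset_range hθ hrange
  refine ⟨θ'.iExs (Fin s.card), ⟨_, inferInstance, θ', hθ', .refl _⟩, iExs_imp_iff.2 ?_, ?_⟩
  · rw [← relabel_imp_relabel_iff (Function.injective_id.sumMap he)]
    exact hθθ'.mpr.trans (hθφ.trans (relabel_comp_iff φ Sum.inl (Sum.map id e)).mp)
  · refine Formula.realize_iExs.2 ⟨e, ?_⟩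
    simpa only [Formula.realize_relabel, Sum.elim_comp_map, Function.comp_id, Function.id_comp]
      using hθθ'.realize_iff.1 hθv

theorem isExistentialModulo_of_isModelComplete (hT : T.IsModelComplete) (φ : L.Formula α) :
    IsExistentialModulo T φ := by
  let P : Set (L.Formula α) := {ρ | IsExistentialModulo T ρ ∧ ρ ⟹[T] φ}
  have hsup : ∀ ρ₁ ∈ P, ∀ ρ₂ ∈ P, ρ₁ ⊔ ρ₂ ∈ P := fun ρ₁ h₁ ρ₂ h₂ =>
    ⟨h₁.1.sup h₂.1, sup_imp_iff.2 ⟨h₁.2, h₂.2⟩⟩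
  have hbot : ⊥ ∈ P :=
    ⟨isExistentialModulo_bot, imp_iff_forall_realize.2 fun _ _ h => h.elim⟩
  obtain ⟨ρ, ⟨hρ, hρφ⟩, hφρ⟩ := exists_imp_of_directedOn ⟨⊥, hbot⟩ (directedOn_imp_of_sup_mem hsup)
    fun M v hv => (exists_isExistentialModulo_imp hT M hv).imp fun ρ h => ⟨⟨h.1, h.2.1⟩, h.2.2⟩
  obtain ⟨γ, hγ, θ, hθ, hρθ⟩ := hρ
  exact ⟨γ, hγ, θ, hθ, (imp_antisymm hφρ hρφ).trans hρθ⟩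

end RobinsonTest

section QuantifierElimination

theorem exists_isQF_iff_of_isExistentialModulo (hT : T.HasGroundInterpolation) {α : Type*}
    [Countable α] {φ : L.Formula α} (hφ : IsExistentialModulo T φ)
    (hφn : IsExistentialModulo T φ.not) : ∃ I : L.Formula α, IsQF I ∧ φ ⇔[T] I := by
  obtain ⟨β, _, A, hA, hφA⟩ := hφ
  obtain ⟨γ, _, B, hB, hφB⟩ := hφn
  have hAφ : A ⟹[T] φ.relabel Sum.inl := iExs_imp_iff.1 hφA.mpr
  have hBφ : B ⟹[T] φ.not.relabel Sum.inl := iExs_imp_iff.1 hφB.mpr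
  have hAB : A.relabel (Sum.map id Sum.inl : _ → α ⊕ (β ⊕ γ)) ⟹[T]
      B.not.relabel (Sum.map id Sum.inr) := imp_iff_forall_realize.2 fun M v hAv hBv => by
    have h₁ := Formula.realize_relabel.1 (realize_of_imp hAφ (Formula.realize_relabel.1 hAv))
    have h₂ := Formula.realize_relabel.1 (realize_of_imp hBφ (Formula.realize_relabel.1 hBv))
    exact h₂ h₁
  obtain ⟨I, hI, hAI, hIB⟩ := exists_isQF_interpolant hT hA hB.not hAB
  have hφI : φ ⟹[T] I := hφA.mp.trans (iExs_imp_iff.2 hAI)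
  have hφIn : φ.not ⟹[T] I.not := hφB.mp.trans (iExs_imp_iff.2 (imp_not_comm.1 hIB))
  exact ⟨I, hI, imp_antisymm hφI (imp_not_not_iff.1 (imp_not_comm.1 hφIn))⟩

theorem hasQuantifierElimination (hT : T.HasGroundInterpolation) (hcomplete : T.IsModelComplete) :
    T.HasQuantifierElimination := fun _ φ =>
  exists_isQF_iff_of_isExistentialModulo hT (isExistentialModulo_of_isModelComplete hcomplete φ)
    (isExistentialModulo_of_isModelComplete hcomplete φ.not)

end QuantifierElimination

section ModelCompletion

theorem exists_isQF_iff_of_hasQuantifierElimination (hT : T.HasQuantifierElimination) {α : Type*}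
    (φ : L.Formula α) : ∃ ψ : L.Formula α, IsQF ψ ∧ φ ⇔[T] ψ := by
  classical
  let f := φ.freeVarFinset.equivFin
  let g : Fin _ → α := Subtype.val ∘ f.symm
  have hg : g.Injective := Subtype.val_injective.comp f.symm.injective
  have hφ : φ ⇔[T] Formula.relabel g (φ.restrictFreeVar f) :=
    iff_relabel_restrictFreeVar φ fun b => congrArg Subtype.val (f.symm_apply_apply b)
  obtain ⟨ψ, hψ, hφψ⟩ := hT _ (φ.restrictFreeVar f)
  exact ⟨ψ.relabel g, isQF_relabel hψ g, hφ.trans <|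
    imp_antisymm ((relabel_imp_relabel_iff hg).2 hφψ.mp) ((relabel_imp_relabel_iff hg).2 hφψ.mpr)⟩

theorem isComplete_onTheory_union_diagram (hT : T.HasQuantifierElimination)
    {M : Type w} [L.Structure M] {N : ModelType.{u, v, max u v w} T} (F : M ↪[L] N) :
    ((L.lhomWithConstants M).onTheory T ∪ L.diagram M).IsComplete := by
  refine ⟨?_, fun σ => ?_⟩
  · let := constantsOn.structure F
    have hN : N ⊨ (L.lhomWithConstants M).onTheory T := (LHom.onTheory_model _ _).2 N.is_model
    have := hN.union (models_diagram_iff_exists_embedding.2 ⟨F, fun _ => rfl⟩)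
    exact Model.isSatisfiable N
  obtain ⟨φ, rfl⟩ := Formula.equivSentence.surjective σ
  obtain ⟨ψ, hψ, hφψ⟩ := exists_isQF_iff_of_hasQuantifierElimination hT φ
  have realize_iff (K : ModelType.{max u w, v, max u v w}
      ((L.lhomWithConstants M).onTheory T ∪ L.diagram M)) :
      K ⊨ Formula.equivSentence φ ↔ ψ.Realize (id : M → M) := by
    let := (L.lhomWithConstants M).reduct K
    have : K ⊨ T := (LHom.onTheory_model (L.lhomWithConstants M) T).1
      (K.is_model.mono Set.subset_union_left)
    obtain ⟨G, hG⟩ := models_diagram_iff_exists_embedding.1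
      (K.is_model.mono (Set.subset_union_right (t := L.diagram M)))
    refine (Formula.realize_equivSentence K φ).trans ?_
    rw [hφψ.realize_iff, ← funext hG]
    exact realize_comp_embedding_iff hψ G id
  simp only [models_sentence_iff, Sentence.realize_not, realize_iff]
  by_cases hψM : ψ.Realize (id : M → M)
  · exact .inl fun _ => hψM
  · exact .inr fun _ => hψM

theorem isModelCompletion (h : Tstar.IsModelCompanion T)
    (hTstar : Tstar.HasQuantifierElimination) : Tstar.IsModelCompletion T :=
  ⟨h, fun M => by
    obtain ⟨N, ⟨F⟩⟩ := h.1.1 M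
    exact isComplete_onTheory_union_diagram hTstar F⟩

end ModelCompletion

end GroundInterpolation

theorem mainTheorem10_general {L : FirstOrder.Language.{u, v}} {T Tstar : L.Theory}
    (hcomp : Tstar.IsModelCompanion T) :
    (T.HasGroundInterpolation →
      Tstar.HasQuantifierElimination ∧ Tstar.IsModelCompletion T) ∧
    (T.HasGroundInterpolation ↔ Tstar.HasGroundInterpolation) := by
  have interpolation_iff := GroundInterpolation.hasGroundInterpolation_congr hcomp.1
  refine ⟨fun hT => ?_, interpolation_iff⟩
  have hTstar : Tstar.HasQuantifierElimination :=
    GroundInterpolation.hasQuantifierElimination (interpolation_iff.1 hT) hcomp.2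
  exact ⟨hTstar, GroundInterpolation.isModelCompletion hcomp hTstar⟩

theorem mainTheorem10 {L : FirstOrder.Language.{u, v}} (T Tstar : L.Theory)
    (hT : T.IsUniversallyAxiomatized) (hcomp : Tstar.IsModelCompanion T) :
    (T.HasGroundInterpolation →
      Tstar.HasQuantifierElimination ∧ Tstar.IsModelCompletion T) ∧
    (T.HasGroundInterpolation ↔ Tstar.HasGroundInterpolation) :=
  mainTheorem10_general hcomp
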